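/- Let $n\ge 2$, $s_1,s_2\in(0,1)$, $\lambda\ge 1$ and $\varrho\in(0,\infty]$. For $i=1,2$ let $K_i\colon\mathbb{R}^n\setminus\{0\}\to[0,+\infty)$ be measurable and even, with $$\frac{\chi_{B_\varrho}(\zeta)}{\lambda|\zeta|^{n+s_i}}\le K_i(\zeta)\le\frac{\lambda}{|\zeta|^{n+s_i}}\qquad\text{for all }\zeta\in\mathbb{R}^n\setminus\{0\},$$ where $B_\varrho$ is the open ball of radius $\varrho$ centred at the origin ($B_\infty=\mathbb{R}^n$). For measurable disjoint $E,F\subseteq\mathbb{R}^n$ put $$I_i(E,F):=\int_E\int_F K_i(x-y)\,dx\,dy\in[0,+\infty],$$ and write $E^c:=\mathbb{R}^n\setminus E$. Let $\Omega\subseteq\mathbb{R}^n$ be open and bounded with $I_1(\Omega,\Omega^c)+I_2(\Omega,\Omega^c)<+\infty$, and let $m\in(0,|\Omega|)$, $g\in L^\infty(\Omega)$ and $\sigma\in\mathbb{R}$. For measurable $E\subseteq\Omega$ define $$\mathcal{C}(E):=I_1(E,E^c\cap\Omega)+\sigma\,I_2(E,\Omega^c)+\int_E g(x)\,dx\in(-\infty,+\infty].$$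 Then $\mathcal{C}$ has a minimizer among all measurable sets $E\subseteq\Omega$ with Lebesgue measure $|E|=m$. Moreover, every such minimizer $E$ satisfies $I_1(E,E^c\cap\Omega)<+\infty$. -/

import Mathlib

open MeasureTheory Set
open scoped ENNReal

noncomputable section

namespace NonlocalCapillarity

/-- The class `K(n, s, lam, rho)` of interaction kernels. A kernel is a function on `ℝⁿ ∖ {0}`; it is
represented by a function on all of `ℝⁿ` whose value at the origin is arbitrary. Measurability is
in the sense of Lebesgue. The ball `B_rho` is `{ζ | ‖ζ‖ₑ < rho}`, which is all of `ℝⁿ` when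
`rho = ∞`; outside `B_rho` the lower bound is just nonnegativity. -/
structure IsKernel (n : ℕ) (s lam : ℝ) (rho : ℝ≥0∞)
    (K : EuclideanSpace ℝ (Fin n) → ℝ) : Prop where
  aemeasurable : AEMeasurable K volume
  even : ∀ ζ, ζ ≠ 0 → K (-ζ) = K ζ
  nonneg : ∀ ζ, ζ ≠ 0 → 0 ≤ K ζ
  lower : ∀ ζ, ζ ≠ 0 → ‖ζ‖ₑ < rho → 1 / (lam * ‖ζ‖ ^ ((n : ℝ) + s)) ≤ K ζ
  upper : ∀ ζ, ζ ≠ 0 → K ζ ≤ lam / ‖ζ‖ ^ ((n : ℝ) + s)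

/-- The interaction `I_K(E, F) = ∫_E ∫_F K(x - y) dx dy ∈ [0, ∞]`. -/
def interaction {n : ℕ} (K : EuclideanSpace ℝ (Fin n) → ℝ)
    (E F : Set (EuclideanSpace ℝ (Fin n))) : ℝ≥0∞ :=
  ∫⁻ x in E, ∫⁻ y in F, ENNReal.ofReal (K (x - y))

/-- The surface energy `I₁(E, Eᶜ ∩ Ω) + σ I₂(E, Ωᶜ)`, with values in the extended reals. When
`I₂(Ω, Ωᶜ) < ∞` and `E ⊆ Ω`, the second term is a real number, so that the sum never has the
indeterminate form `∞ - ∞`. -/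
def energy {n : ℕ} (K₁ K₂ : EuclideanSpace ℝ (Fin n) → ℝ) (Ω : Set (EuclideanSpace ℝ (Fin n)))
    (σ : ℝ) (E : Set (EuclideanSpace ℝ (Fin n))) : EReal :=
  (interaction K₁ E (Eᶜ ∩ Ω) : EReal) + (σ : EReal) * (interaction K₂ E Ωᶜ : EReal)

/-- The capillarity functional: the surface energy plus `∫_E g`. -/
def capillarity {n : ℕ} (K₁ K₂ : EuclideanSpace ℝ (Fin n) → ℝ)
    (Ω : Set (EuclideanSpace ℝ (Fin n))) (σ : ℝ) (g : EuclideanSpace ℝ (Fin n) → ℝ)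
    (E : Set (EuclideanSpace ℝ (Fin n))) : EReal :=
  energy K₁ K₂ Ω σ E + ((∫ x in E, g x : ℝ) : EReal)

/-- The competitors: Lebesgue measurable subsets of `Ω` with Lebesgue measure `m`. -/
def competitors {n : ℕ} (Ω : Set (EuclideanSpace ℝ (Fin n))) (m : ℝ) :
    Set (Set (EuclideanSpace ℝ (Fin n))) :=
  {E | NullMeasurableSet E volume ∧ E ⊆ Ω ∧ volume E = ENNReal.ofReal m}

/-- `E` minimizes the capillarity functional among the subsets of `Ω` with Lebesgue measure `m`. -/
def IsMinimizer {n : ℕ} (K₁ K₂ : EuclideanSpace ℝ (Fin n) → ℝ)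
    (Ω : Set (EuclideanSpace ℝ (Fin n))) (σ : ℝ) (g : EuclideanSpace ℝ (Fin n) → ℝ) (m : ℝ)
    (E : Set (EuclideanSpace ℝ (Fin n))) : Prop :=
  E ∈ competitors Ω m ∧
    ∀ F ∈ competitors Ω m, capillarity K₁ K₂ Ω σ g E ≤ capillarity K₁ K₂ Ω σ g F

end NonlocalCapillarity

end

/-!
The direct method. As `I₂(Ω, Ωᶜ) < ∞`, the wetting energy is the integral over `E` of an integrable
potential, just like `∫_E g`, so that both together are bounded and continuous along almost
everywhere convergence, while Fatou's lemma makes `I₁(E, Eᶜ ∩ Ω)` lower semicontinuous. Since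
`I₁(Ω, Ωᶜ) < ∞`, an energy bound also bounds the nonlocal perimeter `I₁(E, Eᶜ)`, and by a nonlocal
Poincaré inequality the characteristic functions are then uniformly close in `L¹` to the densities
of the sets in small balls. These densities can be taken at countably many balls, so a diagonal
subsequence of them converges, which gives compactness of minimizing sequences. The minimum is not
`+∞`: balls have finite nonlocal perimeter, and the intersection of `Ω` with a ball of suitable
radius has measure `m`.
-/

open Filter Topology Metric
open scoped ProbabilityTheory symmDiff

namespace NonlocalCapillarity

section General

variable {α : Type*} [MeasurableSpace α] {μ : Measure α}

lemma exists_isMinOn_of_forall_seq {X β : Type*} [CompleteLinearOrder β] [TopologicalSpace β]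
    [OrderTopology β] [FirstCountableTopology β] {S : Set X} {f : X → β} {x₀ : X} (hx₀ : x₀ ∈ S)
    (h : ∀ u : ℕ → X, (∀ k, u k ∈ S) → (∀ k, f (u k) ≤ f x₀) → ∃ φ : ℕ → ℕ, StrictMono φ ∧
      ∃ x ∈ S, f x ≤ liminf (fun k => f (u (φ k))) atTop) :
    ∃ x ∈ S, IsMinOn f S x := by
  let T := {x ∈ S | f x ≤ f x₀}
  obtain ⟨v, -, hv, hvT⟩ := exists_seq_tendsto_sInf (S := f '' T) ⟨_, x₀, ⟨hx₀, le_rfl⟩, rfl⟩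
    (OrderBot.bddBelow _)
  choose u hu hfu using hvT
  obtain ⟨φ, hφ, x, hx, hfx⟩ := h u (fun k => (hu k).1) fun k => (hu k).2
  have hx_le : f x ≤ sInf (f '' T) := by
    simp only [hfu] at hfx
    exact hfx.trans (hv.comp hφ.tendsto_atTop).liminf_eq.le
  refine ⟨x, hx, fun y hy => ?_⟩
  rcases le_total (f y) (f x₀) with hyx | hyx
  · exact hx_le.trans (sInf_le ⟨y, ⟨hy, hyx⟩, rfl⟩)
  · exact (hx_le.trans (sInf_le ⟨x₀, ⟨hx₀, le_rfl⟩, rfl⟩)).trans hyx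

lemma tendsto_setIntegral_of_ae_eventually_iff {ι G : Type*} [NormedAddCommGroup G]
    [NormedSpace ℝ G] {l : Filter ι} [l.IsCountablyGenerated] {g : α → G} {Ω E' : Set α}
    {E : ι → Set α} (hg : IntegrableOn g Ω μ) (hE : ∀ i, NullMeasurableSet (E i) μ)
    (hE' : NullMeasurableSet E' μ) (hEΩ : ∀ i, E i ⊆ Ω) (hE'Ω : E' ⊆ Ω)
    (h : ∀ᵐ x ∂μ, ∀ᶠ i in l, x ∈ E i ↔ x ∈ E') :
    Tendsto (fun i => ∫ x in E i, g x ∂μ) l (𝓝 (∫ x in E', g x ∂μ)) := by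
  have hΩ : μ.restrict Ω ≪ μ := Measure.restrict_le_self.absolutelyContinuous
  have integral_eq : ∀ {F : Set α}, NullMeasurableSet F μ → F ⊆ Ω →
      ∫ x in F, g x ∂μ = ∫ x in Ω, F.indicator g x ∂μ := fun hF hFΩ => by
    rw [integral_indicator₀ (hF.mono_ac hΩ), Measure.restrict_restrict₀ (hF.mono_ac hΩ),
      inter_eq_left.2 hFΩ]
  simp only [fun i => integral_eq (hE i) (hEΩ i), integral_eq hE' hE'Ω]
  refine tendsto_integral_filter_of_dominated_convergence (fun x => ‖g x‖)
    (.of_forall fun i => hg.aestronglyMeasurable.indicator₀ ((hE i).mono_ac hΩ))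
    (.of_forall fun i => .of_forall fun x => norm_indicator_le_norm_self _ _) hg.norm
    (ae_restrict_of_ae ?_)
  filter_upwards [h] with x hx
  refine tendsto_const_nhds.congr' ?_
  filter_upwards [hx] with i hi
  by_cases hxE : x ∈ E' <;> simp [hxE, hi]

lemma exists_subseq_ae_eventuallyConst {E : ℕ → Set α}
    (h : ∀ ε : ℝ≥0∞, ε ≠ 0 → ∃ N, ∀ k ≥ N, ∀ l ≥ N, μ (E k ∆ E l) ≤ ε) :
    ∃ φ : ℕ → ℕ, StrictMono φ ∧ ∀ᵐ x ∂μ, EventuallyConst (fun k => x ∈ E (φ k)) atTop := by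
  obtain ⟨φ, hφ, hsymm⟩ := extraction_forall_of_eventually'
    (P := fun j k => ∀ l ≥ k, μ (E k ∆ E l) ≤ (2⁻¹ : ℝ≥0∞) ^ j) fun j => by
      obtain ⟨N, hN⟩ := h (2⁻¹ ^ j) (by simp)
      exact ⟨N, fun k hk l hl => hN k hk l (hk.trans hl)⟩
  have hsum : ∑' j, μ (E (φ j) ∆ E (φ (j + 1))) ≠ ∞ :=
    ne_top_of_le_ne_top (by simp [ENNReal.tsum_geometric])
      (ENNReal.tsum_le_tsum fun j => hsymm j _ (hφ.monotone j.le_succ))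
  refine ⟨φ, hφ, ?_⟩
  filter_upwards [ae_eventually_notMem hsum] with x hx
  obtain ⟨N, hN⟩ := eventually_atTop.1 hx
  refine eventuallyConst_atTop_nat.2 ⟨N, fun k hk => propext ?_⟩
  have := hN k hk
  rw [mem_symmDiff] at this
  tauto

lemma exists_subseq_ae_eventuallyConst_of_forall_approx {E : ℕ → Set α}
    (hE : ∀ k, NullMeasurableSet (E k) μ)
    (h : ∀ ε : ℝ≥0∞, ε ≠ 0 → ∃ g : α → ℝ, Measurable g ∧
      ∀ᶠ k in atTop, ∫⁻ x, ‖(E k).indicator 1 x - g x‖ₑ ∂μ ≤ ε) :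
    ∃ φ : ℕ → ℕ, StrictMono φ ∧ ∀ᵐ x ∂μ, EventuallyConst (fun k => x ∈ E (φ k)) atTop := by
  refine exists_subseq_ae_eventuallyConst fun ε hε => ?_
  obtain ⟨g, hg, hgε⟩ := h (ε / 2) (ENNReal.half_pos hε).ne'
  obtain ⟨N, hN⟩ := eventually_atTop.1 hgε
  have hmeas : ∀ k, AEMeasurable (fun x => ‖(E k).indicator 1 x - g x‖ₑ) μ := fun k =>
    ((aemeasurable_const.indicator₀ (hE k)).sub hg.aemeasurable).enorm
  refine ⟨N, fun k hk l hl => ?_⟩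
  calc μ (E k ∆ E l) = ∫⁻ x, (E k ∆ E l).indicator 1 x ∂μ :=
        (lintegral_indicator_one₀ ((hE k).symmDiff (hE l))).symm
    _ ≤ ∫⁻ x, (‖(E k).indicator 1 x - g x‖ₑ + ‖(E l).indicator 1 x - g x‖ₑ) ∂μ := by
        refine lintegral_mono fun x => ?_
        rw [show (E k ∆ E l).indicator 1 x = ‖(E k).indicator (1 : α → ℝ) x - (E l).indicator 1 x‖ₑ
          by by_cases hk : x ∈ E k <;> by_cases hl : x ∈ E l <;> simp [mem_symmDiff, hk, hl],
          ← sub_sub_sub_cancel_right _ _ (g x)]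
        exact enorm_sub_le
    _ ≤ ε / 2 + ε / 2 := by
        rw [lintegral_add_left' (hmeas k)]
        exact add_le_add (hN k hk) (hN l hl)
    _ = ε := ENNReal.add_halves ε

lemma exists_ae_eventually_mem_iff {Ω : Set α} (hΩ : NullMeasurableSet Ω μ) {F : ℕ → Set α}
    (hF : ∀ k, NullMeasurableSet (F k) μ) (hFΩ : ∀ k, F k ⊆ Ω)
    (h : ∀ᵐ x ∂μ.restrict Ω, EventuallyConst (fun k => x ∈ F k) atTop) :
    ∃ E, NullMeasurableSet E μ ∧ E ⊆ Ω ∧ ∀ᵐ x ∂μ, ∀ᶠ k in atTop, x ∈ F k ↔ x ∈ E := by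
  refine ⟨{x | ∀ᶠ k in atTop, x ∈ F k}, ?_, fun x hx => hx.exists.elim fun k hk => hFΩ k hk, ?_⟩
  · simp only [eventually_atTop, ofPred_exists, ofPred_forall, ofPred_mem_eq]
    exact .iUnion fun N => .iInter fun k => .iInter fun _ => hF k
  · filter_upwards [(ae_restrict_iff'₀ hΩ).1 h] with x hx
    by_cases hxΩ : x ∈ Ω
    · rcases eventuallyConst_pred.1 (hx hxΩ) with hev | hev
      · exact hev.mono fun k hk => iff_of_true hk hev
      · exact hev.mono fun k hk => iff_of_false hk fun hmem =>
          (hev.and hmem).exists.elim fun _ h => h.1 h.2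
    · exact .of_forall fun k => iff_of_false (fun hk => hxΩ (hFΩ k hk)) fun hmem =>
        hmem.exists.elim fun k hk => hxΩ (hFΩ k hk)

lemma exists_subseq_tendsto_measureReal {ι : Type*} [Countable ι] (ν : ι → Measure α)
    [∀ i, IsProbabilityMeasure (ν i)] (E : ℕ → Set α) :
    ∃ φ : ℕ → ℕ, StrictMono φ ∧
      ∀ i, ∃ L, Tendsto (fun k => (ν i).real (E (φ k))) atTop (𝓝 L) := by
  let u : ℕ → ι → unitInterval := fun k i => ⟨(ν i).real (E k), measureReal_nonneg,
    measureReal_le_one⟩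
  obtain ⟨L, φ, hφ, hL⟩ := CompactSpace.tendsto_subseq u
  exact ⟨φ, hφ, fun i => ⟨L i, (continuous_subtype_val.tendsto _).comp (tendsto_pi_nhds.1 hL i)⟩⟩

lemma exists_measurable_dist_denseSeq_lt (X : Type*) [PseudoMetricSpace X]
    [TopologicalSpace.SeparableSpace X] [Nonempty X] [MeasurableSpace X] [OpensMeasurableSpace X]
    {δ : ℝ} (hδ : 0 < δ) :
    ∃ i : X → ℕ, Measurable i ∧ ∀ x, dist x (TopologicalSpace.denseSeq X (i x)) < δ := by
  classical
  have h : ∀ x, ∃ N, dist x (TopologicalSpace.denseSeq X N) < δ := fun x =>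
    (TopologicalSpace.denseRange_denseSeq X).exists_dist_lt x hδ
  exact ⟨fun x => Nat.find (h x), measurable_find h fun N =>
    measurableSet_lt (continuous_id.dist continuous_const).measurable measurable_const,
    fun x => Nat.find_spec (h x)⟩

/-- The centres `q x` range over a countable dense set, so that one diagonal subsequence serves all
balls and all radii. -/
lemma exists_subseq_tendsto_density {X : Type*} [PseudoMetricSpace X] [ProperSpace X] [Nonempty X]
    [MeasurableSpace X] [OpensMeasurableSpace X] (μ ν : Measure X) [μ.IsOpenPosMeasure]
    [IsFiniteMeasureOnCompacts μ] [IsFiniteMeasure ν] {δ : ℕ → ℝ} (hδ : ∀ j, 0 < δ j)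
    (E : ℕ → Set X) :
    ∃ φ : ℕ → ℕ, StrictMono φ ∧ ∀ j, ∃ q : X → X, (∀ x, dist x (q x) < δ j) ∧
      (∀ k, Measurable fun x => (μ[|ball (q x) (δ j)]).real (E (φ k))) ∧
      ∃ g : X → ℝ, Measurable g ∧
        Tendsto (fun k => ∫⁻ x, ‖(μ[|ball (q x) (δ j)]).real (E (φ k)) - g x‖ₑ ∂ν) atTop (𝓝 0) := by
  let p := TopologicalSpace.denseSeq X
  choose i hi hpi using fun j => exists_measurable_dist_denseSeq_lt X (hδ j)
  let P : ℕ × ℕ → Measure X := fun a => μ[|ball (p a.2) (δ a.1)]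
  have hP : ∀ a, IsProbabilityMeasure (P a) := fun a =>
    ProbabilityTheory.cond_isProbabilityMeasure_of_finite
      (measure_ball_pos μ _ (hδ a.1)).ne' measure_ball_lt_top.ne
  obtain ⟨φ, hφ, hlim⟩ := exists_subseq_tendsto_measureReal P E
  choose L hL using hlim
  have hmeas : ∀ (M : ℕ × ℕ → ℝ) j, Measurable fun x => M (j, i j x) := fun M j =>
    (measurable_of_countable fun l => M (j, l)).comp (hi j)
  have hdens : ∀ j k, Measurable fun x => (P (j, i j x)).real (E (φ k)) := fun j k =>
    hmeas (fun a => (P a).real (E (φ k))) j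
  refine ⟨φ, hφ, fun j => ⟨fun x => p (i j x), hpi j, hdens j, fun x => L (j, i j x), hmeas L j,
    ?_⟩⟩
  change Tendsto (fun k => ∫⁻ x, ‖(P (j, i j x)).real (E (φ k)) - L (j, i j x)‖ₑ ∂ν) atTop (𝓝 0)
  simp only [← ofReal_norm]
  refine tendsto_lintegral_norm_of_dominated_convergence (bound := fun _ => (1 : ℝ))
    (fun k => (hdens j k).aestronglyMeasurable)
    (hasFiniteIntegral_const 1) (fun k => .of_forall fun x => ?_) (.of_forall fun x => hL _)
  rw [Real.norm_of_nonneg measureReal_nonneg]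
  exact measureReal_le_one

end General

section Interaction

variable {n : ℕ} {s lam : ℝ} {rho : ℝ≥0∞} {K : EuclideanSpace ℝ (Fin n) → ℝ}
  {E F Ω : Set (EuclideanSpace ℝ (Fin n))}

lemma aemeasurable_kernel_sub (hK : AEMeasurable K volume) :
    AEMeasurable (fun p : EuclideanSpace ℝ (Fin n) × EuclideanSpace ℝ (Fin n) =>
      ENNReal.ofReal (K (p.1 - p.2))) (volume.prod volume) :=
  (hK.comp_quasiMeasurePreserving
    (quasiMeasurePreserving_sub_of_right_invariant volume volume)).ennreal_ofReal

lemma aemeasurable_lintegral_kernel_sub (hK : AEMeasurable K volume)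
    (F : Set (EuclideanSpace ℝ (Fin n))) :
    AEMeasurable (fun x => ∫⁻ y in F, ENNReal.ofReal (K (x - y))) volume :=
  ((aemeasurable_kernel_sub hK).mono_ac
    (Measure.AbsolutelyContinuous.rfl.prod
      Measure.restrict_le_self.absolutelyContinuous)).lintegral_prod_right'

lemma interaction_eq_lintegral_indicator (hK : AEMeasurable K volume)
    (hE : NullMeasurableSet E volume) (hF : NullMeasurableSet F volume) :
    interaction K E F
      = ∫⁻ p, (E ×ˢ F).indicator (fun p => ENNReal.ofReal (K (p.1 - p.2))) p
          ∂(volume.prod volume) := by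
  rw [lintegral_indicator₀ (hE.prod hF), ← Measure.prod_restrict, lintegral_prod, interaction]
  rw [Measure.prod_restrict]
  exact (aemeasurable_kernel_sub hK).restrict

lemma interaction_mono {E' F' : Set (EuclideanSpace ℝ (Fin n))} (hE : E ⊆ E') (hF : F ⊆ F') :
    interaction K E F ≤ interaction K E' F' :=
  (lintegral_mono_set hE).trans (lintegral_mono fun _ => lintegral_mono_set hF)

lemma interaction_compl_le (hK : AEMeasurable K volume) (hE : E ⊆ Ω) :
    interaction K E Eᶜ ≤ interaction K E (Eᶜ ∩ Ω) + interaction K Ω Ωᶜ := by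
  calc interaction K E Eᶜ
      ≤ ∫⁻ x in E, ((∫⁻ y in Eᶜ ∩ Ω, ENNReal.ofReal (K (x - y)))
          + ∫⁻ y in Ωᶜ, ENNReal.ofReal (K (x - y))) := by
        refine lintegral_mono fun x => ?_
        refine (lintegral_mono_set fun y hy => ?_).trans (lintegral_union_le _ _ _)
        by_cases hyΩ : y ∈ Ω
        exacts [Or.inl ⟨hy, hyΩ⟩, Or.inr hyΩ]
    _ = interaction K E (Eᶜ ∩ Ω) + interaction K E Ωᶜ :=
        lintegral_add_right' _ (aemeasurable_lintegral_kernel_sub hK _).restrict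
    _ ≤ interaction K E (Eᶜ ∩ Ω) + interaction K Ω Ωᶜ := by
        gcongr
        exact interaction_mono hE Subset.rfl

lemma IsKernel.interaction_comm [NeZero n] (hK : IsKernel n s lam rho K)
    (E F : Set (EuclideanSpace ℝ (Fin n))) : interaction K E F = interaction K F E := by
  unfold interaction
  rw [lintegral_lintegral_swap]
  · refine lintegral_congr fun x => lintegral_congr_ae (ae_restrict_of_ae ?_)
    filter_upwards [Measure.ae_ne volume x] with y hy
    rw [← hK.even (x - y) (sub_ne_zero.2 hy.symm), neg_sub]
  · rw [Measure.prod_restrict]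
    exact (aemeasurable_kernel_sub hK.aemeasurable).restrict

lemma interaction_le_liminf {E F : ℕ → Set (EuclideanSpace ℝ (Fin n))}
    {E' F' : Set (EuclideanSpace ℝ (Fin n))} (hK : AEMeasurable K volume)
    (hE : ∀ k, NullMeasurableSet (E k) volume) (hF : ∀ k, NullMeasurableSet (F k) volume)
    (hE' : NullMeasurableSet E' volume) (hF' : NullMeasurableSet F' volume)
    (hEE : ∀ᵐ x, x ∈ E' → ∀ᶠ k in atTop, x ∈ E k)
    (hFF : ∀ᵐ x, x ∈ F' → ∀ᶠ k in atTop, x ∈ F k) :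
    interaction K E' F' ≤ liminf (fun k => interaction K (E k) (F k)) atTop := by
  simp only [fun k => interaction_eq_lintegral_indicator hK (hE k) (hF k),
    interaction_eq_lintegral_indicator hK hE' hF']
  refine (lintegral_mono_ae ?_).trans
    (lintegral_liminf_le' fun k => (aemeasurable_kernel_sub hK).indicator₀ ((hE k).prod (hF k)))
  filter_upwards [Measure.quasiMeasurePreserving_fst.ae hEE,
    Measure.quasiMeasurePreserving_snd.ae hFF] with p hp hp'
  by_cases h : p ∈ E' ×ˢ F'
  · refine le_liminf_of_le (by isBoundedDefault) ?_
    filter_upwards [hp h.1, hp' h.2] with k hk hk'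
    rw [indicator_of_mem h, indicator_of_mem (mk_mem_prod hk hk')]
  · rw [indicator_of_notMem h]
    exact zero_le

lemma interaction_eq_lintegral_mul_volume (hK : AEMeasurable K volume) (hE : MeasurableSet E)
    (hF : MeasurableSet F) :
    interaction K E F
      = ∫⁻ z, ENNReal.ofReal (K z) * volume (E ∩ (fun x => x - z) ⁻¹' F) := by
  have key : ∀ x, E.indicator (fun x => ∫⁻ y in F, ENNReal.ofReal (K (x - y))) x
      = ∫⁻ z, ENNReal.ofReal (K z) * (E ∩ (fun x => x - z) ⁻¹' F).indicator 1 x := by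
    intro x
    by_cases hx : x ∈ E
    · rw [indicator_of_mem hx, ← lintegral_indicator hF, ← lintegral_sub_left_eq_self _ x]
      refine lintegral_congr fun z => ?_
      by_cases hz : x - z ∈ F <;> simp [hx, hz]
    · simp [hx]
  rw [interaction, ← lintegral_indicator hE]
  simp only [key]
  rw [lintegral_lintegral_swap]
  · refine lintegral_congr fun z => ?_
    have : MeasurableSet (E ∩ (fun x => x - z) ⁻¹' F) :=
      hE.inter ((measurable_id.sub_const z) hF)
    rw [lintegral_const_mul _ (measurable_one.indicator this), lintegral_indicator_one this]
  · refine AEMeasurable.mul ?_ ?_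
    · exact hK.ennreal_ofReal.comp_quasiMeasurePreserving Measure.quasiMeasurePreserving_snd
    · exact (measurable_one.indicator ((measurable_fst hE).inter
        ((measurable_fst.sub measurable_snd) hF))).aemeasurable

end Interaction

section FiniteEnergy

variable {n : ℕ} {s lam : ℝ} {rho : ℝ≥0∞} {K : EuclideanSpace ℝ (Fin n) → ℝ}

lemma measure_ball_diff_ball_le {V : Type*} [NormedAddCommGroup V] [NormedSpace ℝ V]
    [FiniteDimensional ℝ V] [Nontrivial V] [MeasurableSpace V] [BorelSpace V] (μ : Measure V)
    [μ.IsAddHaarMeasure] (x : V) {r d : ℝ} (hr : 0 ≤ r) (hd : 0 ≤ d) :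
    μ (ball x r \ ball x (r - d))
      ≤ ENNReal.ofReal (d * Module.finrank ℝ V * r ^ (Module.finrank ℝ V - 1)) * μ (ball 0 1) := by
  rcases le_total d r with hdr | hdr
  · rw [measure_sdiff (ball_subset_ball (sub_le_self r hd)) measurableSet_ball.nullMeasurableSet
      measure_ball_lt_top.ne, Measure.addHaar_ball _ _ hr,
      Measure.addHaar_ball _ _ (sub_nonneg.2 hdr),
      ← ENNReal.sub_mul fun _ _ => measure_ball_lt_top.ne,
      ← ENNReal.ofReal_sub _ (pow_nonneg (sub_nonneg.2 hdr) _)]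
    gcongr
    have := (le_abs_self _).trans (abs_pow_sub_pow_le r (r - d) (Module.finrank ℝ V))
    rwa [sub_sub_cancel, abs_of_nonneg hd, abs_of_nonneg hr, abs_of_nonneg (sub_nonneg.2 hdr),
      max_eq_left (sub_le_self r hd)] at this
  · rw [ball_eq_empty.2 (sub_nonpos.2 hdr), sdiff_empty, Measure.addHaar_ball _ _ hr]
    gcongr
    have hdim : 1 ≤ Module.finrank ℝ V := Module.finrank_pos
    calc r ^ Module.finrank ℝ V = r * 1 * r ^ (Module.finrank ℝ V - 1) := by
          rw [mul_one, mul_pow_sub_one (by omega)]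
      _ ≤ d * Module.finrank ℝ V * r ^ (Module.finrank ℝ V - 1) := by
          gcongr
          exact_mod_cast hdim

lemma exists_measure_ball_diff_ball_le_mul_min {V : Type*} [NormedAddCommGroup V]
    [NormedSpace ℝ V] [FiniteDimensional ℝ V] [Nontrivial V] [MeasurableSpace V] [BorelSpace V]
    (μ : Measure V) [μ.IsAddHaarMeasure] (x : V) {r : ℝ} (hr : 0 ≤ r) :
    ∃ C : ℝ≥0∞, C ≠ ∞ ∧
      ∀ d, 0 ≤ d → μ (ball x r \ ball x (r - d)) ≤ C * ENNReal.ofReal (min 1 d) := by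
  let C := ENNReal.ofReal (Module.finrank ℝ V * r ^ (Module.finrank ℝ V - 1)) * μ (ball 0 1)
  have hC : C ≠ ∞ := ENNReal.mul_ne_top ENNReal.ofReal_ne_top measure_ball_lt_top.ne
  refine ⟨C + μ (ball x r), ENNReal.add_ne_top.2 ⟨hC, measure_ball_lt_top.ne⟩, fun d hd => ?_⟩
  rcases le_total d 1 with hd1 | hd1
  · calc μ (ball x r \ ball x (r - d))
        ≤ ENNReal.ofReal (d * Module.finrank ℝ V * r ^ (Module.finrank ℝ V - 1)) * μ (ball 0 1) :=
          measure_ball_diff_ball_le μ x hr hd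
      _ = C * ENNReal.ofReal d := by
          rw [mul_assoc d, ENNReal.ofReal_mul hd, mul_assoc, mul_comm]
      _ ≤ (C + μ (ball x r)) * ENNReal.ofReal (min 1 d) := by
          rw [min_eq_right hd1]
          gcongr
          exact le_self_add
  · rw [min_eq_left hd1, ENNReal.ofReal_one, mul_one]
    exact (measure_mono sdiff_subset).trans le_add_self

lemma integrable_min_one_norm_mul_rpow_norm [NeZero n] (hs : s ∈ Ioo (0 : ℝ) 1) :
    Integrable fun z : EuclideanSpace ℝ (Fin n) => min 1 ‖z‖ * ‖z‖ ^ (-(n + s)) := by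
  have hn : 1 ≤ n := NeZero.one_le
  rw [integrable_fun_norm_addHaar volume (f := fun y : ℝ => min 1 y * y ^ (-(n + s))),
    finrank_euclideanSpace_fin, ← Ioc_union_Ioi_eq_Ioi zero_le_one]
  have hpow : ∀ y : ℝ, 0 < y → y ^ (n - 1) * y ^ (-(n + s)) = y ^ (-1 - s) := fun y hy => by
    rw [← Real.rpow_natCast, ← Real.rpow_add hy, Nat.cast_sub hn]
    congr 1
    push_cast
    ring
  refine IntegrableOn.union ?_ ?_
  · rw [integrableOn_Ioc_iff_integrableOn_Ioo]
    refine ((intervalIntegral.integrableOn_Ioo_rpow_iff (s := -s) one_pos).2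
      (by linarith [hs.2])).congr_fun (fun y hy => ?_) measurableSet_Ioo
    simp only [smul_eq_mul]
    rw [min_eq_right hy.2.le, mul_left_comm, hpow y hy.1, ← Real.rpow_one_add' hy.1.le
      (by linarith [hs.1])]
    congr 1
    ring
  · refine (integrableOn_Ioi_rpow_of_lt (a := -1 - s) (by linarith [hs.1]) one_pos).congr_fun
      (fun y hy => ?_) measurableSet_Ioi
    simp only [smul_eq_mul]
    rw [min_eq_left (le_of_lt hy), one_mul, hpow y (one_pos.trans hy)]

lemma IsKernel.interaction_ball_compl_lt_top [NeZero n] (hK : IsKernel n s lam rho K)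
    (hs : s ∈ Ioo (0 : ℝ) 1) (r : ℝ) : interaction K (ball 0 r) (ball 0 r)ᶜ < ∞ := by
  rcases le_or_gt r 0 with hr | hr
  · simp [interaction, ball_eq_empty.2 hr]
  obtain ⟨C, hC, hdiff⟩ := exists_measure_ball_diff_ball_le_mul_min
    (volume : Measure (EuclideanSpace ℝ (Fin n))) 0 hr.le
  rw [interaction_eq_lintegral_mul_volume hK.aemeasurable measurableSet_ball
    measurableSet_ball.compl]
  calc ∫⁻ z, ENNReal.ofReal (K z) * volume (ball 0 r ∩ (fun x => x - z) ⁻¹' (ball 0 r)ᶜ)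
      ≤ ∫⁻ z, ENNReal.ofReal lam * C *
          ENNReal.ofReal (min 1 ‖z‖ * ‖z‖ ^ (-(n + s))) := by
        refine lintegral_mono_ae ?_
        filter_upwards [Measure.ae_ne volume 0] with z hz
        have hinter : volume (ball 0 r ∩ (fun x => x - z) ⁻¹' (ball 0 r)ᶜ)
            ≤ C * ENNReal.ofReal (min 1 ‖z‖) := by
          refine (measure_mono fun x hx => ?_).trans (hdiff ‖z‖ (norm_nonneg z))
          refine ⟨hx.1, fun hx' => hx.2 ?_⟩
          rw [mem_ball_zero_iff] at hx' ⊢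
          linarith [norm_sub_le x z]
        have hupper : ENNReal.ofReal (K z)
            ≤ ENNReal.ofReal lam * ENNReal.ofReal (‖z‖ ^ (-(n + s))) := by
          rw [← ENNReal.ofReal_mul' (by positivity), Real.rpow_neg (norm_nonneg z),
            ← div_eq_mul_inv]
          exact ENNReal.ofReal_le_ofReal (hK.upper z hz)
        rw [ENNReal.ofReal_mul (by positivity)]
        exact (mul_le_mul' hupper hinter).trans_eq (by ring)
    _ = ENNReal.ofReal lam * C *
          ∫⁻ z : EuclideanSpace ℝ (Fin n), ENNReal.ofReal (min 1 ‖z‖ * ‖z‖ ^ (-(n + s))) :=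
        lintegral_const_mul' _ _ (ENNReal.mul_ne_top ENNReal.ofReal_ne_top hC)
    _ < ∞ := ENNReal.mul_lt_top (ENNReal.mul_lt_top ENNReal.ofReal_lt_top hC.lt_top)
        (integrable_min_one_norm_mul_rpow_norm hs).lintegral_lt_top

lemma exists_measure_ball_eq {X : Type*} [PseudoMetricSpace X] [MeasurableSpace X]
    [OpensMeasurableSpace X] {μ : Measure X} [IsFiniteMeasure μ] (x : X)
    (hsphere : ∀ r, μ (sphere x r) = 0) {c : ℝ≥0∞} (hc : c < μ univ) :
    ∃ r, μ (ball x r) = c := by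
  have hcont : Continuous fun r => μ (ball x r) := by
    refine continuous_iff_continuousAt.2 fun r => ?_
    refine tendsto_measure_of_ae_tendsto_indicator_of_isFiniteMeasure (𝓝 r) measurableSet_ball
      (fun _ => measurableSet_ball) ?_
    filter_upwards [measure_eq_zero_iff_ae_notMem.1 (hsphere r)] with y hy
    rcases lt_or_gt_of_ne hy with h | h
    · filter_upwards [lt_mem_nhds h] with t ht using iff_of_true ht h
    · filter_upwards [gt_mem_nhds h] with t ht using iff_of_false ht.not_gt h.not_gt
  have hlim : Tendsto (fun k : ℕ => μ (ball x k)) atTop (𝓝 (μ univ)) := by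
    rw [← iUnion_ball_nat x]
    exact tendsto_measure_iUnion_atTop fun _ _ h => ball_subset_ball (by exact_mod_cast h)
  obtain ⟨N, hN⟩ := (hlim.eventually_const_lt hc).exists
  exact mem_range_of_exists_le_of_exists_ge hcont ⟨0, by simp⟩ ⟨N, hN.le⟩

lemma IsKernel.exists_competitor_interaction_lt_top [NeZero n]
    {Ω : Set (EuclideanSpace ℝ (Fin n))} {m : ℝ} (hK : IsKernel n s lam rho K)
    (hs : s ∈ Ioo (0 : ℝ) 1) (hΩ : NullMeasurableSet Ω volume)
    (hΩfin : volume Ω ≠ ∞) (hm : ENNReal.ofReal m < volume Ω) :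
    ∃ E ∈ competitors Ω m, interaction K E (Eᶜ ∩ Ω) < ∞ := by
  have : IsFiniteMeasure (volume.restrict Ω) := isFiniteMeasure_restrict.2 hΩfin
  obtain ⟨r, hr⟩ := exists_measure_ball_eq (μ := volume.restrict Ω) 0
    (fun r => Measure.restrict_le_self.absolutelyContinuous (Measure.addHaar_sphere _ _ _))
    (c := ENNReal.ofReal m) (by simpa using hm)
  rw [Measure.restrict_apply measurableSet_ball] at hr
  refine ⟨ball 0 r ∩ Ω, ⟨measurableSet_ball.nullMeasurableSet.inter hΩ, inter_subset_right, hr⟩,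
    (interaction_mono inter_subset_left fun x hx => ?_).trans_lt
      (hK.interaction_ball_compl_lt_top hs r)⟩
  exact fun hxr => hx.1 ⟨hxr, hx.2⟩

end FiniteEnergy

section Compactness

variable {n : ℕ} {s lam : ℝ} {rho : ℝ≥0∞} {K : EuclideanSpace ℝ (Fin n) → ℝ}

lemma IsKernel.one_le_mul (hK : IsKernel n s lam rho K) (hlam : 0 < lam) (hs : 0 ≤ s)
    {z : EuclideanSpace ℝ (Fin n)} (hz : z ≠ 0) {t : ℝ} (hzt : ‖z‖ < t)
    (ht : ENNReal.ofReal t ≤ rho) :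
    1 ≤ ENNReal.ofReal (lam * t ^ (n + s)) * ENNReal.ofReal (K z) := by
  have hz0 : 0 < ‖z‖ := norm_pos_iff.2 hz
  have ht0 : 0 < t := hz0.trans hzt
  have hlow : 1 / (lam * ‖z‖ ^ (n + s)) ≤ K z := by
    refine hK.lower z hz (lt_of_lt_of_le ?_ ht)
    rw [← ofReal_norm]
    exact (ENNReal.ofReal_lt_ofReal_iff ht0).2 hzt
  rw [← ENNReal.ofReal_mul (by positivity), ENNReal.one_le_ofReal, ← div_le_iff₀' (by positivity)]
  exact hlow.trans' (by gcongr)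

/-- The constant in the nonlocal Poincaré inequality at scale `δ`. -/
noncomputable def poincareConst (n : ℕ) (s lam δ : ℝ) : ℝ≥0∞ :=
  ENNReal.ofReal (lam * (2 * δ) ^ (n + s)) / volume (ball (0 : EuclideanSpace ℝ (Fin n)) δ)

lemma tendsto_poincareConst [NeZero n] (hs : 0 < s) (lam : ℝ) :
    Tendsto (poincareConst n s lam) (𝓝[>] 0) (𝓝 0) := by
  set v := volume (ball (0 : EuclideanSpace ℝ (Fin n)) 1)
  have hv : v ≠ 0 := (measure_ball_pos _ _ one_pos).ne'
  have heq : ∀ δ ∈ Ioi (0 : ℝ), ENNReal.ofReal (lam * 2 ^ (n + s) * δ ^ s) / v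
      = poincareConst n s lam δ := fun δ (hδ : 0 < δ) => by
    rw [poincareConst, Measure.addHaar_ball _ _ hδ.le, finrank_euclideanSpace_fin,
      Real.mul_rpow zero_le_two hδ.le, Real.rpow_add hδ, Real.rpow_natCast,
      show lam * (2 ^ (n + s) * (δ ^ n * δ ^ s)) = δ ^ n * (lam * 2 ^ (n + s) * δ ^ s) by ring,
      ENNReal.ofReal_mul (p := δ ^ n) (by positivity)]
    rw [ENNReal.mul_div_mul_left _ _ (by positivity) ENNReal.ofReal_ne_top]
  refine Tendsto.congr' (eventually_mem_nhdsWithin.mono heq) ?_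
  have hcont : Tendsto (fun δ : ℝ => lam * 2 ^ (n + s) * δ ^ s) (𝓝[>] 0) (𝓝 0) := by
    have := (((Real.continuous_rpow_const hs.le).tendsto 0).const_mul (lam * 2 ^ (n + s)))
    rw [Real.zero_rpow hs.ne', mul_zero] at this
    exact this.mono_left nhdsWithin_le_nhds
  simpa using ENNReal.Tendsto.div_const (ENNReal.tendsto_ofReal hcont) (Or.inr hv)

lemma IsKernel.cond_ball_le (hK : IsKernel n s lam rho K) (hlam : 0 < lam) (hs : 0 ≤ s) {δ : ℝ}
    (hrho : ENNReal.ofReal (2 * δ) ≤ rho) {x y : EuclideanSpace ℝ (Fin n)} (hxy : dist x y < δ)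
    {G : Set (EuclideanSpace ℝ (Fin n))} (hG : NullMeasurableSet G volume) (hx : x ∉ G) :
    volume[G | ball y δ]
      ≤ poincareConst n s lam δ * ∫⁻ z in G, ENNReal.ofReal (K (x - z)) := by
  rw [ProbabilityTheory.cond_apply measurableSet_ball, Measure.addHaar_ball_center, poincareConst,
    div_eq_mul_inv, mul_comm _ (_)⁻¹, mul_assoc]
  gcongr
  rw [← lintegral_const_mul' _ _ ENNReal.ofReal_ne_top, ← setLIntegral_one]
  refine (lintegral_mono_ae ?_).trans (lintegral_mono_set inter_subset_right)
  filter_upwards [ae_restrict_mem₀ (measurableSet_ball.nullMeasurableSet.inter hG)] with z hz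
  refine hK.one_le_mul hlam hs (sub_ne_zero.2 (ne_of_mem_of_not_mem hz.2 hx).symm) ?_ hrho
  rw [← dist_eq_norm]
  linarith [dist_triangle_right x z y, mem_ball.1 hz.1]

/-- A nonlocal Poincaré inequality. The balls are not centred at `x`, so that the centres `q x` can
be taken in a countable set. -/
lemma IsKernel.lintegral_enorm_indicator_sub_density_le [NeZero n] (hK : IsKernel n s lam rho K)
    (hlam : 0 < lam) (hs : 0 ≤ s) {δ : ℝ} (hrho : ENNReal.ofReal (2 * δ) ≤ rho)
    {q : EuclideanSpace ℝ (Fin n) → EuclideanSpace ℝ (Fin n)} (hq : ∀ x, dist x (q x) < δ)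
    {E : Set (EuclideanSpace ℝ (Fin n))} (hE : NullMeasurableSet E volume) :
    ∫⁻ x, ‖E.indicator 1 x - (volume[|ball (q x) δ]).real E‖ₑ
      ≤ poincareConst n s lam δ * (2 * interaction K E Eᶜ) := by
  have hδ : 0 < δ := dist_nonneg.trans_lt (hq 0)
  have hconst : poincareConst n s lam δ ≠ ∞ :=
    ENNReal.div_ne_top ENNReal.ofReal_ne_top (measure_ball_pos _ _ hδ).ne'
  let f := fun x => ‖E.indicator 1 x - (volume[|ball (q x) δ]).real E‖ₑ
  have hf_mem : ∀ x ∈ E, f x = volume[Eᶜ | ball (q x) δ] := fun x hx => by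
    have := ProbabilityTheory.cond_isProbabilityMeasure_of_finite
      (measure_ball_pos volume (q x) hδ).ne' measure_ball_lt_top.ne
    simp only [f, indicator_of_mem hx, Pi.one_apply]
    rw [← probReal_compl_eq_one_sub₀ (hE.mono_ac ProbabilityTheory.cond_absolutelyContinuous),
      Real.enorm_of_nonneg measureReal_nonneg, ofReal_measureReal]
  have hf_notMem : ∀ x ∈ Eᶜ, f x = volume[E | ball (q x) δ] := fun x hx => by
    simp only [f, indicator_of_notMem hx, zero_sub, enorm_neg]
    rw [Real.enorm_of_nonneg measureReal_nonneg, ofReal_measureReal]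
  calc ∫⁻ x, f x = ∫⁻ x in E ∪ Eᶜ, f x := by rw [union_compl_self, Measure.restrict_univ]
    _ ≤ (∫⁻ x in E, f x) + ∫⁻ x in Eᶜ, f x := lintegral_union_le _ _ _
    _ ≤ poincareConst n s lam δ * interaction K E Eᶜ
        + poincareConst n s lam δ * interaction K Eᶜ E := by
      unfold interaction
      rw [← lintegral_const_mul' _ _ hconst, ← lintegral_const_mul' _ _ hconst]
      refine add_le_add (lintegral_mono_ae ?_) (lintegral_mono_ae ?_)
      · filter_upwards [ae_restrict_mem₀ hE] with x hx
        exact (hf_mem x hx).trans_le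
          (hK.cond_ball_le hlam hs hrho (hq x) hE.compl (not_not.2 hx))
      · filter_upwards [ae_restrict_mem₀ hE.compl] with x hx
        exact (hf_notMem x hx).trans_le (hK.cond_ball_le hlam hs hrho (hq x) hE hx)
    _ = poincareConst n s lam δ * (2 * interaction K E Eᶜ) := by
      rw [hK.interaction_comm Eᶜ, ← two_mul, mul_left_comm]

lemma IsKernel.setLIntegral_enorm_indicator_sub_le [NeZero n] (hK : IsKernel n s lam rho K)
    (hlam : 0 < lam) (hs : 0 ≤ s) {δ : ℝ} (hrho : ENNReal.ofReal (2 * δ) ≤ rho)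
    {q : EuclideanSpace ℝ (Fin n) → EuclideanSpace ℝ (Fin n)} (hq : ∀ x, dist x (q x) < δ)
    {E Ω : Set (EuclideanSpace ℝ (Fin n))} (hE : NullMeasurableSet E volume)
    (hqE : Measurable fun x => (volume[|ball (q x) δ]).real E)
    {g : EuclideanSpace ℝ (Fin n) → ℝ} (hg : Measurable g) :
    ∫⁻ x in Ω, ‖E.indicator 1 x - g x‖ₑ ≤ poincareConst n s lam δ * (2 * interaction K E Eᶜ)
      + ∫⁻ x in Ω, ‖(volume[|ball (q x) δ]).real E - g x‖ₑ :=
  have hdiff : Measurable fun x => ‖(volume[|ball (q x) δ]).real E - g x‖ₑ := (hqE.sub hg).enorm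
  calc ∫⁻ x in Ω, ‖E.indicator 1 x - g x‖ₑ
      ≤ ∫⁻ x in Ω, (‖E.indicator 1 x - (volume[|ball (q x) δ]).real E‖ₑ
          + ‖(volume[|ball (q x) δ]).real E - g x‖ₑ) := by
        refine lintegral_mono fun x => ?_
        rw [← sub_add_sub_cancel]
        exact enorm_add_le _ _
    _ = (∫⁻ x in Ω, ‖E.indicator 1 x - (volume[|ball (q x) δ]).real E‖ₑ)
          + ∫⁻ x in Ω, ‖(volume[|ball (q x) δ]).real E - g x‖ₑ := lintegral_add_right _ hdiff
    _ ≤ _ := by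
        gcongr
        exact (setLIntegral_le_lintegral _ _).trans
          (hK.lintegral_enorm_indicator_sub_density_le hlam hs hrho hq hE)

lemma IsKernel.exists_subseq_ae_eventuallyConst [NeZero n] (hK : IsKernel n s lam rho K)
    (hlam : 0 < lam) (hs : 0 < s) (hrho : 0 < rho) {Ω : Set (EuclideanSpace ℝ (Fin n))}
    (hΩfin : volume Ω ≠ ∞) {E : ℕ → Set (EuclideanSpace ℝ (Fin n))}
    (hE : ∀ k, NullMeasurableSet (E k) volume) {C : ℝ≥0∞} (hC : C ≠ ∞)
    (hEC : ∀ k, interaction K (E k) (E k)ᶜ ≤ C) :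
    ∃ φ : ℕ → ℕ, StrictMono φ ∧
      ∀ᵐ x ∂volume.restrict Ω, EventuallyConst (fun k => x ∈ E (φ k)) atTop := by
  let δ : ℕ → ℝ := fun j => 1 / (j + 1)
  have hδ : ∀ j, 0 < δ j := fun j => Nat.one_div_pos_of_nat
  have hδ_lim : Tendsto δ atTop (𝓝 0) := tendsto_one_div_add_atTop_nhds_zero_nat
  have hpoincare : Tendsto (fun j => poincareConst n s lam (δ j) * (2 * C)) atTop (𝓝 0) := by
    simpa using ENNReal.Tendsto.mul_const ((tendsto_poincareConst hs lam).comp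
      (tendsto_nhdsWithin_iff.2 ⟨hδ_lim, .of_forall hδ⟩))
      (Or.inr (ENNReal.mul_ne_top ENNReal.ofNat_ne_top hC))
  have hscale : Tendsto (fun j => ENNReal.ofReal (2 * δ j)) atTop (𝓝 0) := by
    simpa using ENNReal.tendsto_ofReal (hδ_lim.const_mul 2)
  have : IsFiniteMeasure (volume.restrict Ω) := isFiniteMeasure_restrict.2 hΩfin
  obtain ⟨φ, hφ, hdens⟩ := exists_subseq_tendsto_density volume (volume.restrict Ω) hδ E
  obtain ⟨ψ, hψ, hconst⟩ := exists_subseq_ae_eventuallyConst_of_forall_approx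
    (μ := volume.restrict Ω) (E := fun k => E (φ k))
    (fun k => (hE _).mono_ac Measure.restrict_le_self.absolutelyContinuous) fun ε hε => by
      obtain ⟨j, hjε, hjrho⟩ := ((hpoincare.eventually_le_const (ENNReal.half_pos hε)).and
        (hscale.eventually_le_const hrho)).exists
      obtain ⟨q, hq, hqE, g, hg, hqg⟩ := hdens j
      refine ⟨g, hg, (hqg.eventually_le_const (ENNReal.half_pos hε)).mono fun k hk => ?_⟩
      calc ∫⁻ x in Ω, ‖(E (φ k)).indicator 1 x - g x‖ₑ
          ≤ poincareConst n s lam (δ j) * (2 * interaction K (E (φ k)) (E (φ k))ᶜ)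
              + ∫⁻ x in Ω, ‖(volume[|ball (q x) (δ j)]).real (E (φ k)) - g x‖ₑ :=
            hK.setLIntegral_enorm_indicator_sub_le hlam hs.le hjrho hq (hE _) (hqE k) hg
        _ ≤ poincareConst n s lam (δ j) * (2 * C) + ε / 2 := by
            gcongr
            exact hEC _
        _ ≤ ε / 2 + ε / 2 := by gcongr
        _ = ε := ENNReal.add_halves ε
  exact ⟨φ ∘ ψ, hφ.comp hψ, hconst⟩

lemma IsKernel.exists_subseq_tendsto_competitor [NeZero n] (hK : IsKernel n s lam rho K)
    (hlam : 0 < lam) (hs : 0 < s) (hrho : 0 < rho) {Ω : Set (EuclideanSpace ℝ (Fin n))}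
    (hΩ : NullMeasurableSet Ω volume) (hΩfin : volume Ω ≠ ∞)
    (hper : interaction K Ω Ωᶜ ≠ ∞) {m : ℝ} {F : ℕ → Set (EuclideanSpace ℝ (Fin n))}
    (hF : ∀ k, F k ∈ competitors Ω m) {B : ℝ≥0∞} (hB : B ≠ ∞)
    (hFB : ∀ k, interaction K (F k) ((F k)ᶜ ∩ Ω) ≤ B) :
    ∃ φ : ℕ → ℕ, StrictMono φ ∧ ∃ E ∈ competitors Ω m,
      ∀ᵐ x, ∀ᶠ k in atTop, x ∈ F (φ k) ↔ x ∈ E := by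
  obtain ⟨φ, hφ, hconst⟩ := hK.exists_subseq_ae_eventuallyConst hlam hs hrho hΩfin
    (fun k => (hF k).1) (ENNReal.add_ne_top.2 ⟨hB, hper⟩) fun k =>
      (interaction_compl_le hK.aemeasurable (hF k).2.1).trans (by gcongr; exact hFB k)
  obtain ⟨E, hE, hEΩ, hFE⟩ := exists_ae_eventually_mem_iff hΩ (fun k => (hF (φ k)).1)
    (fun k => (hF (φ k)).2.1) hconst
  have hvol : Tendsto (fun k => volume.real (F (φ k))) atTop (𝓝 (volume.real E)) := by
    have : IntegrableOn (fun _ => (1 : ℝ)) Ω := integrableOn_const hΩfin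
    simpa using tendsto_setIntegral_of_ae_eventually_iff this (fun k => (hF (φ k)).1) hE
      (fun k => (hF (φ k)).2.1) hEΩ hFE
  have hvolE : volume.real E = (ENNReal.ofReal m).toReal := by
    simp only [measureReal_def, (hF _).2.2] at hvol
    exact tendsto_nhds_unique hvol tendsto_const_nhds
  refine ⟨φ, hφ, E, ⟨hE, hEΩ, ?_⟩, hFE⟩
  rwa [measureReal_def, ENNReal.toReal_eq_toReal_iff' (measure_ne_top_of_subset hEΩ hΩfin)
    ENNReal.ofReal_ne_top] at hvolE

end Compactness

section Capillarity

variable {n : ℕ} {K₁ K₂ : EuclideanSpace ℝ (Fin n) → ℝ} {Ω E : Set (EuclideanSpace ℝ (Fin n))}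
  {σ m : ℝ} {g : EuclideanSpace ℝ (Fin n) → ℝ}

/-- The sum of the wetting energy and the potential energy, as a potential: its integral over
`E ⊆ Ω` is `σ I₂(E, Ωᶜ) + ∫_E g`. The inner integral is finite for almost every `x ∈ Ω` as soon as
`I₂(Ω, Ωᶜ) < ∞`. -/
noncomputable def wettingPotential (K₂ : EuclideanSpace ℝ (Fin n) → ℝ)
    (Ω : Set (EuclideanSpace ℝ (Fin n))) (σ : ℝ) (g : EuclideanSpace ℝ (Fin n) → ℝ)
    (x : EuclideanSpace ℝ (Fin n)) : ℝ :=
  σ * (∫⁻ y in Ωᶜ, ENNReal.ofReal (K₂ (x - y))).toReal + g x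

lemma integrableOn_wettingPotential (hK₂ : AEMeasurable K₂ volume)
    (hper : interaction K₂ Ω Ωᶜ ≠ ∞) (hg : IntegrableOn g Ω) :
    IntegrableOn (wettingPotential K₂ Ω σ g) Ω :=
  ((integrable_toReal_of_lintegral_ne_top
    (aemeasurable_lintegral_kernel_sub hK₂ Ωᶜ).restrict hper).const_mul σ).add hg

lemma integral_wettingPotential (hK₂ : AEMeasurable K₂ volume)
    (hper : interaction K₂ Ω Ωᶜ ≠ ∞) (hg : IntegrableOn g Ω) (hE : E ⊆ Ω) :
    ∫ x in E, wettingPotential K₂ Ω σ g x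
      = σ * (interaction K₂ E Ωᶜ).toReal + ∫ x in E, g x := by
  have hmeas := (aemeasurable_lintegral_kernel_sub hK₂ Ωᶜ).restrict (s := E)
  have hfin : interaction K₂ E Ωᶜ ≠ ∞ := ne_top_of_le_ne_top hper (interaction_mono hE Subset.rfl)
  unfold wettingPotential
  rw [integral_add ((integrable_toReal_of_lintegral_ne_top hmeas hfin).const_mul σ)
    (hg.mono_set hE), integral_const_mul, integral_toReal hmeas (ae_lt_top' hmeas hfin),
    interaction]

lemma capillarity_eq_add_integral (hK₂ : AEMeasurable K₂ volume)
    (hper : interaction K₂ Ω Ωᶜ ≠ ∞) (hg : IntegrableOn g Ω) (hE : E ⊆ Ω) :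
    capillarity K₁ K₂ Ω σ g E = (interaction K₁ E (Eᶜ ∩ Ω) : EReal)
      + ((∫ x in E, wettingPotential K₂ Ω σ g x : ℝ) : EReal) := by
  have hfin : interaction K₂ E Ωᶜ ≠ ∞ := ne_top_of_le_ne_top hper (interaction_mono hE Subset.rfl)
  rw [capillarity, energy, integral_wettingPotential hK₂ hper hg hE, add_assoc, EReal.coe_add,
    EReal.coe_mul, EReal.coe_ennreal_toReal hfin]

lemma capillarity_lt_top_iff (hK₂ : AEMeasurable K₂ volume)
    (hper : interaction K₂ Ω Ωᶜ ≠ ∞) (hg : IntegrableOn g Ω) (hE : E ⊆ Ω) :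
    capillarity K₁ K₂ Ω σ g E < ⊤ ↔ interaction K₁ E (Eᶜ ∩ Ω) < ∞ := by
  rw [capillarity_eq_add_integral hK₂ hper hg hE, lt_top_iff_ne_top, lt_top_iff_ne_top,
    EReal.add_ne_top_iff_of_ne_bot_of_ne_top (EReal.coe_ne_bot _) (EReal.coe_ne_top _), ne_eq,
    EReal.coe_ennreal_eq_top_iff]

lemma interaction_le_of_capillarity_le (hK₂ : AEMeasurable K₂ volume)
    (hper : interaction K₂ Ω Ωᶜ ≠ ∞) (hg : IntegrableOn g Ω) (hE : E ⊆ Ω) {c : ℝ}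
    (hc : capillarity K₁ K₂ Ω σ g E ≤ c) :
    interaction K₁ E (Eᶜ ∩ Ω) ≤ ENNReal.ofReal (c + ∫ x in Ω, ‖wettingPotential K₂ Ω σ g x‖) := by
  set w := wettingPotential K₂ Ω σ g
  rw [capillarity_eq_add_integral hK₂ hper hg hE, ← EReal.le_sub_iff_add_le (by simp) (by simp),
    ← EReal.coe_sub] at hc
  have hint : ‖∫ x in E, w x‖ ≤ ∫ x in Ω, ‖w x‖ :=
    (norm_integral_le_integral_norm w).trans (setIntegral_mono_set
      (integrableOn_wettingPotential hK₂ hper hg).norm (.of_forall fun x => norm_nonneg _)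
      (.of_forall hE))
  rw [← EReal.coe_ennreal_le_coe_ennreal_iff, EReal.coe_ennreal_ofReal]
  refine hc.trans (EReal.coe_le_coe ((le_max_left _ _).trans' ?_))
  linarith [neg_le_of_abs_le hint]

lemma capillarity_le_liminf (hK₁ : AEMeasurable K₁ volume) (hK₂ : AEMeasurable K₂ volume)
    (hper : interaction K₂ Ω Ωᶜ ≠ ∞) (hg : IntegrableOn g Ω) (hΩ : NullMeasurableSet Ω volume)
    {F : ℕ → Set (EuclideanSpace ℝ (Fin n))} (hF : ∀ k, NullMeasurableSet (F k) volume)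
    (hE : NullMeasurableSet E volume) (hFΩ : ∀ k, F k ⊆ Ω) (hEΩ : E ⊆ Ω)
    (hFE : ∀ᵐ x, ∀ᶠ k in atTop, x ∈ F k ↔ x ∈ E) :
    capillarity K₁ K₂ Ω σ g E ≤ liminf (fun k => capillarity K₁ K₂ Ω σ g (F k)) atTop := by
  have hint : (interaction K₁ E (Eᶜ ∩ Ω) : EReal)
      ≤ liminf (fun k => (interaction K₁ (F k) ((F k)ᶜ ∩ Ω) : EReal)) atTop := by
    refine (EReal.coe_ennreal_le_coe_ennreal_iff.2 ?_).trans_eq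
      (EReal.coe_ennreal_strictMono.monotone.map_liminf_of_continuousAt _
        continuous_coe_ennreal_ereal.continuousAt)
    refine interaction_le_liminf hK₁ hF (fun k => (hF k).compl.inter hΩ) hE (hE.compl.inter hΩ)
      ?_ ?_ <;> filter_upwards [hFE] with x hx hxE <;> filter_upwards [hx] with k hk
    exacts [hk.2 hxE, ⟨fun h => hxE.1 (hk.1 h), hxE.2⟩]
  have hwet : Tendsto (fun k => ((∫ x in F k, wettingPotential K₂ Ω σ g x : ℝ) : EReal)) atTop
      (𝓝 ((∫ x in E, wettingPotential K₂ Ω σ g x : ℝ) : EReal)) :=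
    (continuous_coe_real_ereal.tendsto _).comp (tendsto_setIntegral_of_ae_eventually_iff
      (integrableOn_wettingPotential hK₂ hper hg) hF hE hFΩ hEΩ hFE)
  simp only [fun k => capillarity_eq_add_integral (K₁ := K₁) (σ := σ) hK₂ hper hg (hFΩ k),
    capillarity_eq_add_integral hK₂ hper hg hEΩ]
  calc _ ≤ liminf (fun k => (interaction K₁ (F k) ((F k)ᶜ ∩ Ω) : EReal)) atTop
        + liminf (fun k => ((∫ x in F k, wettingPotential K₂ Ω σ g x : ℝ) : EReal)) atTop := by
        rw [hwet.liminf_eq]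
        gcongr
    _ ≤ _ := EReal.le_liminf_add

end Capillarity

end NonlocalCapillarity

open NonlocalCapillarity

theorem proposition1p1_general (n : ℕ) [NeZero n] (s₁ lam : ℝ) (rho : ℝ≥0∞)
    (hs₁ : s₁ ∈ Ioo (0 : ℝ) 1) (hlam : 0 < lam) (hrho : 0 < rho)
    (K₁ K₂ : EuclideanSpace ℝ (Fin n) → ℝ) (hK₁ : IsKernel n s₁ lam rho K₁)
    (hK₂ : AEMeasurable K₂ volume) (_hK₂_nonneg : ∀ ζ, ζ ≠ 0 → 0 ≤ K₂ ζ)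
    (Ω : Set (EuclideanSpace ℝ (Fin n))) (hΩ : NullMeasurableSet Ω volume)
    (hΩfin : volume Ω ≠ ∞) (hper₁ : interaction K₁ Ω Ωᶜ ≠ ∞) (hper₂ : interaction K₂ Ω Ωᶜ ≠ ∞)
    (σ : ℝ) (m : NNReal) (hm : m < volume Ω)
    (g : EuclideanSpace ℝ (Fin n) → ℝ) (hg : IntegrableOn g Ω) :
    (∃ E, IsMinimizer K₁ K₂ Ω σ g m E) ∧
    (∀ E, IsMinimizer K₁ K₂ Ω σ g m E → interaction K₁ E (Eᶜ ∩ Ω) < ∞) := by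
  obtain ⟨E₀, hE₀, hE₀fin⟩ := hK₁.exists_competitor_interaction_lt_top hs₁ hΩ hΩfin
    (m := m) (by rwa [ENNReal.ofReal_coe_nnreal])
  have hE₀cap : capillarity K₁ K₂ Ω σ g E₀ < ⊤ :=
    (capillarity_lt_top_iff hK₂ hper₂ hg hE₀.2.1).2 hE₀fin
  constructor
  · refine exists_isMinOn_of_forall_seq (f := capillarity K₁ K₂ Ω σ g) hE₀ fun F hF hFcap => ?_
    obtain ⟨φ, hφ, E, hE, hFE⟩ := hK₁.exists_subseq_tendsto_competitor hlam hs₁.1 hrho hΩ hΩfin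
      hper₁ hF ENNReal.ofReal_ne_top fun k => interaction_le_of_capillarity_le hK₂ hper₂ hg
        (hF k).2.1 ((hFcap k).trans (EReal.le_coe_toReal hE₀cap.ne))
    exact ⟨φ, hφ, E, hE, capillarity_le_liminf hK₁.aemeasurable hK₂ hper₂ hg hΩ
      (fun k => (hF (φ k)).1) hE.1 (fun k => (hF (φ k)).2.1) hE.2.1 hFE⟩
  · exact fun E hE => (capillarity_lt_top_iff hK₂ hper₂ hg hE.1.2.1).1
      ((hE.2 E₀ hE₀).trans_lt hE₀cap)

theorem proposition1p1 (n : ℕ) (hn : 2 ≤ n) (s₁ s₂ lam : ℝ) (rho : ℝ≥0∞)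
    (hs₁ : s₁ ∈ Set.Ioo (0 : ℝ) 1) (hs₂ : s₂ ∈ Set.Ioo (0 : ℝ) 1)
    (hlam : 1 ≤ lam) (hrho : 0 < rho)
    (K₁ K₂ : EuclideanSpace ℝ (Fin n) → ℝ)
    (hK₁ : NonlocalCapillarity.IsKernel n s₁ lam rho K₁)
    (hK₂ : NonlocalCapillarity.IsKernel n s₂ lam rho K₂)
    (Ω : Set (EuclideanSpace ℝ (Fin n))) (hΩo : IsOpen Ω) (hΩb : Bornology.IsBounded Ω)
    (hper : NonlocalCapillarity.interaction K₁ Ω Ωᶜ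
      + NonlocalCapillarity.interaction K₂ Ω Ωᶜ < ∞)
    (σ m : ℝ) (hm0 : 0 < m) (hm : ENNReal.ofReal m < volume Ω)
    (g : EuclideanSpace ℝ (Fin n) → ℝ) (hg : MemLp g ∞ (volume.restrict Ω)) :
    (∃ E, NonlocalCapillarity.IsMinimizer K₁ K₂ Ω σ g m E) ∧
    (∀ E, NonlocalCapillarity.IsMinimizer K₁ K₂ Ω σ g m E →
      NonlocalCapillarity.interaction K₁ E (Eᶜ ∩ Ω) < ∞) := by
  have : NeZero n := ⟨by omega⟩
  have hper' := ENNReal.add_ne_top.1 hper.ne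
  have : IsFiniteMeasure (volume.restrict Ω) := isFiniteMeasure_restrict.2 hΩb.measure_lt_top.ne
  exact proposition1p1_general n s₁ lam rho hs₁ (by linarith) hrho K₁ K₂ hK₁ hK₂.aemeasurable
    hK₂.nonneg Ω hΩo.measurableSet.nullMeasurableSet hΩb.measure_lt_top.ne hper'.1 hper'.2 σ
    (.mk m hm0.le) (by rwa [← ENNReal.ofReal_eq_coe_nnreal hm0.le]) g (hg.integrable le_top)
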